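/- Let $n\ge 2$ and let $A=(a_{ij})$ be an $n\times n$ nonnegative irreducible real matrix with $a_{ii}=0$ for all $i$. Let $r_i=\sum_{j} a_{ij}$ be its row sums and $s_i=\sum_{j} a_{ij}r_j$. Let $t_1,\dots,t_n\ge 0$, let $B=A+\mathrm{diag}(t_1,\dots,t_n)$, and let $\rho(B)$ be the spectral radius of $B$, i.e. the largest modulus of its (complex) eigenvalues. For $1\le i,j\le n$ put $$f(i,j)=\frac{t_i+t_j+\sqrt{(t_i-t_j)^2+\frac{4s_is_j}{r_ir_j}}}{2}.$$ Then $$\min\{f(i,j): a_{ij}\ne 0\}\ \le\ \rho(B)\ \le\ \max\{f(i,j): a_{ij}\neq 0\}.$$ Moreover, the left equality holds if and only if (i) or (ii) below holds, and likewise the right equality holds if and only if (i) or (ii) holds: (i) $t_i+\frac{s_i}{r_i}=t_j+\frac{s_j}{r_j}$ for all $i,j\in\{1,\dots,n\}$; (ii) after a suitable simultaneous permutation of the indices (applied to the rows and columns of $B$, and accordingly to the $t_i,r_i,s_i$), there are an integer $k$ with $1\le k<n$ and a real number $l>0$ such that $$B=\begin{pmatrix}\mathrm{diag}(t_1,\dots,t_k)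 & A_{12}\\ A_{21} & \mathrm{diag}(t_{k+1},\dots,t_n)\end{pmatrix}$$ for some blocks $A_{12},A_{21}$, and $$t_1+\frac{l s_1}{r_1}=\dots=t_k+\frac{l s_k}{r_k}=t_{k+1}+\frac{s_{k+1}}{l r_{k+1}}=\dots=t_n+\frac{s_n}{l r_n}.$$ In addition, if the left equality holds and (i) fails, then (ii) holds with some $l>1$; if the right equality holds and (i) fails, then (ii) holds with some $l<1$ (for suitable choices of the permutation and of $k$). -/

import Mathlib

/-- The spectral radius of a real square matrix: the largest modulus of its complex eigenvalues. -/
noncomputable def specRad {n : ℕ} (B : Matrix (Fin n) (Fin n) ℝ) : ℝ :=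
  (spectralRadius ℂ (B.map (fun x : ℝ => (x : ℂ)))).toReal

/-- The row sum `r_i`. -/
def rowSum {n : ℕ} (A : Matrix (Fin n) (Fin n) ℝ) (i : Fin n) : ℝ :=
  ∑ j, A i j

/-- The weighted row sum `s_i = ∑_j a_ij r_j`. -/
def rowSum₂ {n : ℕ} (A : Matrix (Fin n) (Fin n) ℝ) (i : Fin n) : ℝ :=
  ∑ j, A i j * rowSum A j

/-- The quantity `f(i,j) = (t_i + t_j + √((t_i - t_j)² + 4 s_i s_j / (r_i r_j))) / 2`. -/
noncomputable def pairBound {n : ℕ} (A : Matrix (Fin n) (Fin n) ℝ) (t : Fin n → ℝ)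
    (i j : Fin n) : ℝ :=
  (t i + t j + Real.sqrt ((t i - t j) ^ 2 +
    4 * rowSum₂ A i * rowSum₂ A j / (rowSum A i * rowSum A j))) / 2

/-- The set of all values `f(i,j)` over the pairs with `a_ij ≠ 0`. -/
def pairBounds {n : ℕ} (A : Matrix (Fin n) (Fin n) ℝ) (t : Fin n → ℝ) : Set ℝ :=
  {x | ∃ i j : Fin n, A i j ≠ 0 ∧ x = pairBound A t i j}

/-- The condition that `t_i + s_i / r_i` does not depend on `i`. -/
def ConstCond {n : ℕ} (A : Matrix (Fin n) (Fin n) ℝ) (t : Fin n → ℝ) : Prop :=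
  ∀ i j : Fin n, t i + rowSum₂ A i / rowSum A i = t j + rowSum₂ A j / rowSum A j

/-- With the indices split into the first `k` and the last `n - k`, both diagonal blocks of `B`
are diagonal matrices. -/
def IsTwoBlock {n : ℕ} (B : Matrix (Fin n) (Fin n) ℝ) (k : ℕ) : Prop :=
  ∀ i j : Fin n, i ≠ j → ((i : ℕ) < k ↔ (j : ℕ) < k) → B i j = 0

/-- The bipartite equality condition for a given `l`: after some simultaneous permutation `σ` of rows and columns,
`B = A + diag(t)` has the two-block form for some `1 ≤ k < n`, and the numbers `t_i + l s_i / r_i`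
(first block) and `t_j + s_j / (l r_j)` (second block) are all equal. -/
def BlockCond {n : ℕ} (A : Matrix (Fin n) (Fin n) ℝ) (t : Fin n → ℝ) (l : ℝ) : Prop :=
  ∃ (σ : Equiv.Perm (Fin n)) (k : ℕ), 1 ≤ k ∧ k < n ∧
    IsTwoBlock ((A + Matrix.diagonal t).submatrix σ σ) k ∧
    ∃ c : ℝ,
      (∀ i : Fin n, (i : ℕ) < k →
        t (σ i) + l * rowSum₂ A (σ i) / rowSum A (σ i) = c) ∧
      (∀ j : Fin n, k ≤ (j : ℕ) →
        t (σ j) + rowSum₂ A (σ j) / (l * rowSum A (σ j)) = c)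

/-! Let `y` be a Perron vector of `B`, with eigenvalue `c = ρ(B)`. Put `x i = y i / r i`, `u i = (c
- t i) r i / s i` and weights `w i j = a i j * r j`, whose row sums are `s i`. The eigenvalue
equation says that the `w`-mean of `x` over the neighbours of `i` is `u i * x i`, while `f(i,j) ≤ c`
means `u i * u j ≥ 1`, and dually.

The core is a rigidity statement, `pairBound_eq_specRad_of_one_sided`: if `u i * u j` lies on one
side of `1` on every edge, then it equals `1` on every edge. This follows by propagating an extremum
of `x` along two-step walks (`neighbors_of_extremal`, `Matrix.IsIrreducible.mul_eq_one_of_edge`). It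
yields both bounds, and in either equality case all `f(i,j)` on edges equal `c`. Then `u` is
identically `1`, giving (i), or alternates between some `l` and `l⁻¹`, giving (ii). Conversely, (i)
and (ii) exhibit explicit Perron vectors. -/

/-! ### Irreducible nonnegative matrices. -/

open Matrix Finset in
theorem Matrix.pow_apply_le_pow_apply {ι : Type*} [Fintype ι] [DecidableEq ι] {A B : Matrix ι ι ℝ}
    (hA : ∀ i j, 0 ≤ A i j) (hAB : ∀ i j, A i j ≤ B i j) (k : ℕ) (i j : ι) :
    (A ^ k) i j ≤ (B ^ k) i j := by
  induction k generalizing j with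
  | zero => simp
  | succ k ih =>
    rw [pow_succ, pow_succ, mul_apply, mul_apply]
    exact sum_le_sum fun l _ => mul_le_mul (ih l) (hAB l j) (hA l j)
      ((pow_apply_nonneg hA k i l).trans (ih l))

open Matrix in
theorem Matrix.IsIrreducible.mono {ι : Type*} [Fintype ι] [DecidableEq ι] {A B : Matrix ι ι ℝ}
    (hA : A.IsIrreducible) (hAB : ∀ i j, A i j ≤ B i j) : B.IsIrreducible := by
  rw [isIrreducible_iff_exists_pow_pos fun i j => (hA.nonneg i j).trans (hAB i j)]
  intro i j
  obtain ⟨k, hk, h⟩ := (isIrreducible_iff_exists_pow_pos hA.nonneg).1 hA i j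
  exact ⟨k, hk, h.trans_le (pow_apply_le_pow_apply hA.nonneg hAB k i j)⟩

open Matrix in
/-- A nonempty set of indices closed under the edges of an irreducible matrix is everything. -/
theorem Matrix.IsIrreducible.forall_of_closed {ι : Type*} [Fintype ι] [DecidableEq ι]
    {A : Matrix ι ι ℝ} (hA : A.IsIrreducible) {p : ι → Prop} {i₀ : ι} (h₀ : p i₀)
    (hp : ∀ i j, p i → A i j ≠ 0 → p j) (j : ι) : p j := by
  obtain ⟨k, -, h⟩ := (isIrreducible_iff_exists_pow_pos hA.nonneg).1 hA i₀ j
  replace h := h.ne'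
  clear * - h h₀ hp
  induction k generalizing j with
  | zero =>
    by_cases hj : i₀ = j
    · exact hj ▸ h₀
    · simp [hj] at h
  | succ k ih =>
    rw [pow_succ, mul_apply] at h
    obtain ⟨l, -, hl⟩ := Finset.exists_ne_zero_of_sum_ne_zero h
    exact hp l j (ih l (left_ne_zero_of_mul hl)) (right_ne_zero_of_mul hl)

open Matrix Finset in
theorem Matrix.mulVec_pos_of_pos {ι : Type*} [Fintype ι] {Q : Matrix ι ι ℝ}
    (hQ : ∀ i j, 0 < Q i j) {z : ι → ℝ} (hz : ∀ i, 0 ≤ z i) (hz0 : z ≠ 0) (i : ι) :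
    0 < (Q *ᵥ z) i := by
  obtain ⟨j, hj⟩ := Function.ne_iff.1 hz0
  exact sum_pos' (fun k _ => mul_nonneg (hQ i k).le (hz k))
    ⟨j, mem_univ j, mul_pos (hQ i j) (lt_of_le_of_ne (hz j) (Ne.symm hj))⟩

/-! ### Perron vectors and the spectral radius. -/

open Matrix Finset in
/-- An irreducible matrix commutes with some entrywise positive matrix. -/
theorem Matrix.IsIrreducible.exists_commute_pos {ι : Type*} [Fintype ι] [DecidableEq ι]
    {B : Matrix ι ι ℝ} (hB : B.IsIrreducible) :
    ∃ Q : Matrix ι ι ℝ, Commute B Q ∧ ∀ i j, 0 < Q i j := by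
  choose k _ hk using (isIrreducible_iff_exists_pow_pos hB.nonneg).1 hB
  -- `Q` sums one power of `B` for each pair `(i, j)`, chosen to be positive at that entry.
  refine ⟨∑ i, ∑ j, B ^ k i j, Commute.sum_right _ _ _ fun i _ => Commute.sum_right _ _ _
    fun j _ => (Commute.refl B).pow_right _, fun i j => ?_⟩
  simp only [Matrix.sum_apply]
  have hn : ∀ a b, 0 ≤ (B ^ k a b) i j := fun a b => pow_apply_nonneg hB.nonneg _ i j
  exact sum_pos' (fun a _ => sum_nonneg fun b _ => hn a b)
    ⟨i, mem_univ i, sum_pos' (fun b _ => hn i b) ⟨j, mem_univ j, hk i j⟩⟩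

open Matrix Finset in
/-- The Collatz–Wielandt maximum is attained. -/
theorem Matrix.exists_max_collatzWielandt {ι : Type*} [Fintype ι] [Nonempty ι]
    {B : Matrix ι ι ℝ} (hB : ∀ i j, 0 ≤ B i j) :
    ∃ (c : ℝ) (x : ι → ℝ), x ∈ stdSimplex ℝ ι ∧ 0 ≤ c ∧ (∀ i, c * x i ≤ (B *ᵥ x) i) ∧
      ∀ (d : ℝ) (y : ι → ℝ), y ∈ stdSimplex ℝ ι → 0 ≤ d → (∀ i, d * y i ≤ (B *ᵥ y) i) → d ≤ c := by
  classical
  set R : ℝ := ∑ i, ∑ j, B i j with hR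
  -- Summing over `i` bounds every feasible `d` by the total of the entries, so feasible pairs form
  -- a compact set.
  have hbound : ∀ (d : ℝ) (y : ι → ℝ), y ∈ stdSimplex ℝ ι → (∀ i, d * y i ≤ (B *ᵥ y) i) →
      d ≤ R := by
    intro d y hy h
    calc d = ∑ i, d * y i := by rw [← mul_sum, hy.2, mul_one]
      _ ≤ ∑ i, (B *ᵥ y) i := sum_le_sum fun i _ => h i
      _ ≤ R := sum_le_sum fun i _ => sum_le_sum fun j _ =>
        mul_le_of_le_one_right (hB i j) (hy.2 ▸ single_le_sum (fun k _ => hy.1 k) (mem_univ j))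
  set K : Set (ℝ × (ι → ℝ)) := (Set.Icc 0 R ×ˢ stdSimplex ℝ ι) ∩
    {p | ∀ i, p.1 * p.2 i ≤ (B *ᵥ p.2) i} with hK
  have hKc : IsCompact K := by
    refine (isCompact_Icc.prod (isCompact_stdSimplex ℝ ι)).inter_right ?_
    simp only [Set.ofPred_forall]
    refine isClosed_iInter fun i => isClosed_le (by fun_prop) ?_
    simp only [mulVec, dotProduct]
    fun_prop
  have hKn : K.Nonempty := by
    obtain ⟨i⟩ := ‹Nonempty ι›
    refine ⟨(0, Pi.single i 1), ⟨⟨⟨le_rfl, ?_⟩, single_mem_stdSimplex ℝ i⟩, fun j => ?_⟩⟩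
    · exact sum_nonneg fun i _ => sum_nonneg fun j _ => hB i j
    · simpa using hB j i
  obtain ⟨⟨c, x⟩, ⟨⟨hc, hx⟩, hcx⟩, hmax⟩ := hKc.exists_isMaxOn hKn continuous_fst.continuousOn
  exact ⟨c, x, hx, hc.1, hcx, fun d y hy hd h =>
    hmax (a := (d, y)) ⟨⟨⟨hd, hbound d y hy h⟩, hy⟩, h⟩⟩

open Matrix Finset in
/-- Existence of a Perron vector. -/
theorem Matrix.IsIrreducible.exists_pos_eigenvector {ι : Type*} [Fintype ι] [DecidableEq ι]
    [Nonempty ι] {B : Matrix ι ι ℝ} (hB : B.IsIrreducible) :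
    ∃ (c : ℝ) (y : ι → ℝ), (∀ i, 0 < y i) ∧ B *ᵥ y = c • y := by
  obtain ⟨Q, hQB, hQ⟩ := hB.exists_commute_pos
  obtain ⟨c, x, hx, hc, hcx, hmax⟩ := exists_max_collatzWielandt hB.nonneg
  have hx0 : x ≠ 0 := by
    rintro rfl
    simpa using hx.2
  have hy := mulVec_pos_of_pos hQ hx.1 hx0
  have hcomm : B *ᵥ (Q *ᵥ x) = Q *ᵥ (B *ᵥ x) := by
    rw [mulVec_mulVec, mulVec_mulVec, hQB.eq]
  refine ⟨c, Q *ᵥ x, hy, ?_⟩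
  -- If `Q *ᵥ x` is not an eigenvector, the slack `z = B *ᵥ x - c • x` is nonzero, so `Q *ᵥ z` is
  -- positive everywhere. Then `c` can be raised by `ε` at `Q *ᵥ x`, against maximality.
  by_contra hne
  set y := Q *ᵥ x with hydef
  set z := B *ᵥ x - c • x with hz
  have hz0 : z ≠ 0 := by
    intro h
    apply hne
    rw [hcomm, sub_eq_zero.1 h, mulVec_smul]
  have hQz := mulVec_pos_of_pos hQ (fun i => sub_nonneg.2 (hcx i) : ∀ i, 0 ≤ z i) hz0
  have hBy : B *ᵥ y = c • y + Q *ᵥ z := by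
    rw [hcomm, hz, mulVec_sub, mulVec_smul]
    abel
  obtain ⟨i₀, -, hi₀⟩ := exists_min_image univ (fun i => (Q *ᵥ z) i / y i) univ_nonempty
  set ε := (Q *ᵥ z) i₀ / y i₀ with hε
  have hεpos : 0 < ε := div_pos (hQz i₀) (hy i₀)
  have hS : 0 < ∑ i, y i := sum_pos (fun i _ => hy i) univ_nonempty
  have := hmax (c + ε) ((∑ i, y i)⁻¹ • y) ⟨fun i => ?_, ?_⟩ (by linarith) fun i => ?_
  · linarith
  · exact mul_nonneg (inv_nonneg.2 hS.le) (hy i).le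
  · simp only [Pi.smul_apply, smul_eq_mul, ← mul_sum]
    exact inv_mul_cancel₀ hS.ne'
  · rw [mulVec_smul, Pi.smul_apply, Pi.smul_apply, smul_eq_mul, smul_eq_mul, mul_left_comm]
    refine mul_le_mul_of_nonneg_left ?_ (inv_nonneg.2 hS.le)
    have h := (le_div_iff₀ (hy i)).1 (hi₀ i (mem_univ i))
    rw [hBy, Pi.add_apply, Pi.smul_apply, smul_eq_mul, add_mul]
    linarith

open Matrix Finset in
/-- The eigenvalue of a nonnegative matrix at a positive eigenvector is the spectral radius. -/
theorem specRad_eq_of_pos_eigenvector {n : ℕ} [NeZero n] {B : Matrix (Fin n) (Fin n) ℝ}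
    (hB : ∀ i j, 0 ≤ B i j) {c : ℝ} {v : Fin n → ℝ} (hv : ∀ i, 0 < v i)
    (h : B *ᵥ v = c • v) : specRad B = c := by
  have hrow : ∀ i, ∑ j, B i j * v j = c * v i := fun i => congrFun h i
  have hc : 0 ≤ c := by
    have := hrow 0 ▸ sum_nonneg fun j _ => mul_nonneg (hB 0 j) (hv j).le
    exact nonneg_of_mul_nonneg_left this (hv 0)
  have key : spectralRadius ℂ (B.map (fun x : ℝ => (x : ℂ))) = ENNReal.ofReal c := by
    refine le_antisymm (iSup₂_le fun μ hμ => ?_) ?_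
    · rw [← spectrum_toLin', ← Module.End.hasEigenvalue_iff_mem_spectrum] at hμ
      obtain ⟨w, hw⟩ := hμ.exists_hasEigenvector
      have hw1 : ∀ i, ∑ j, (B i j : ℂ) * w j = μ * w i := fun i => by
        simpa [mulVec, dotProduct] using congrFun hw.apply_eq_smul i
      -- The eigenvalue equation is read at the index where `w` attains its sup norm weighted by
      -- `v`.
      obtain ⟨i, -, hi⟩ := exists_max_image univ (fun i => ‖w i‖ / v i) univ_nonempty
      have hle : ∀ j, ‖w j‖ ≤ ‖w i‖ / v i * v j := fun j =>
        (div_le_iff₀ (hv j)).1 (hi j (mem_univ j))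
      have hwi : 0 < ‖w i‖ := by
        obtain ⟨j, hj⟩ := Function.ne_iff.1 hw.2
        have h1 := (norm_pos_iff.2 hj).trans_le (hle j)
        by_contra h2
        have h3 : ‖w i‖ = 0 := le_antisymm (not_lt.1 h2) (norm_nonneg _)
        simp [h3] at h1
      have hmu : ‖μ‖ ≤ c := by
        refine le_of_mul_le_mul_right ?_ hwi
        calc ‖μ‖ * ‖w i‖ = ‖∑ j, (B i j : ℂ) * w j‖ := by rw [hw1, norm_mul]
          _ ≤ ∑ j, B i j * (‖w i‖ / v i * v j) := by
            refine norm_sum_le_of_le _ fun j _ => ?_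
            rw [norm_mul, Complex.norm_real, Real.norm_of_nonneg (hB i j)]
            exact mul_le_mul_of_nonneg_left (hle j) (hB i j)
          _ = ‖w i‖ / v i * ∑ j, B i j * v j := by
            rw [mul_sum]
            exact sum_congr rfl fun j _ => by ring
          _ = c * ‖w i‖ := by
            rw [hrow]
            field_simp [(hv i).ne']
      rw [← enorm_eq_nnnorm, ← ofReal_norm]
      exact ENNReal.ofReal_le_ofReal hmu
    · have hmem : (c : ℂ) ∈ spectrum ℂ (B.map (fun x : ℝ => (x : ℂ))) := by
        rw [← spectrum_toLin', ← Module.End.hasEigenvalue_iff_mem_spectrum]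
        refine Module.End.hasEigenvalue_of_hasEigenvector (x := fun i => (v i : ℂ)) ⟨?_, ?_⟩
        · rw [Module.End.mem_eigenspace_iff]
          ext i
          simpa [mulVec, dotProduct] using congrArg (fun r : ℝ => (r : ℂ)) (hrow i)
        · intro h0
          simpa [(hv 0).ne'] using congrFun h0 0
      refine le_trans (le_of_eq ?_) (le_iSup₂ (f := fun (k : ℂ) (_ : k ∈ spectrum ℂ _) =>
        (‖k‖₊ : ENNReal)) (c : ℂ) hmem)
      rw [← enorm_eq_nnnorm, ← ofReal_norm, Complex.norm_real, Real.norm_of_nonneg hc]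
  rw [specRad, key, ENNReal.toReal_ofReal hc]

/-! ### Rigidity by propagating an extremum. -/

open Finset in
/-- If a weighted mean equals an extremal value, then all values of positive weight agree with it.
The sign of `ε` decides between maximum and minimum. -/
theorem eq_of_extremal_weighted_sum {ι : Type*} [Fintype ι] {w x : ι → ℝ} {ε X : ℝ} (hε : ε ≠ 0)
    (hw : ∀ j, 0 ≤ w j) (hx : ∀ j, w j ≠ 0 → ε * x j ≤ ε * X)
    (h : ε * (X * ∑ j, w j) ≤ ε * ∑ j, w j * x j) (j : ι) (hj : w j ≠ 0) : x j = X := by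
  have hn : ∀ j ∈ univ, 0 ≤ w j * (ε * X - ε * x j) := fun j _ => by
    by_cases h0 : w j = 0
    · simp [h0]
    · exact mul_nonneg (hw j) (sub_nonneg.2 (hx j h0))
  have hsum : ∑ j, w j * (ε * X - ε * x j) = ε * (X * ∑ j, w j) - ε * ∑ j, w j * x j := by
    simp only [mul_sum, ← sum_sub_distrib]
    exact sum_congr rfl fun j _ => by ring
  have h0 := (sum_eq_zero_iff_of_nonneg hn).1
    (le_antisymm (by linarith) (sum_nonneg hn)) j (mem_univ j)
  have h1 := (mul_eq_zero.1 h0).resolve_left hj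
  exact mul_left_cancel₀ hε (by linarith)

open Finset in
theorem weighted_sum_le {ι : Type*} [Fintype ι] {w x : ι → ℝ} {ε X : ℝ}
    (hw : ∀ j, 0 ≤ w j) (hx : ∀ j, ε * x j ≤ ε * X) :
    ε * ∑ j, w j * x j ≤ ε * (X * ∑ j, w j) := by
  simp only [mul_sum]
  exact sum_le_sum fun j _ => by nlinarith [mul_le_mul_of_nonneg_left (hx j) (hw j)]

-- For `ε > 0`, where `X` is a maximum: the mean at `q` gives `u q * x q ≤ X`, hence `x q ≤ u p * X`
-- for every neighbour `q` of `p`. The mean of these values is exactly `u p * X`, so all are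
-- equalities. The mean at `q` is then at least `X`, which forces `x = X` on the neighbours of `q`.
-- For `ε < 0` the inequalities reverse.
open Finset in
theorem neighbors_of_extremal {ι : Type*} [Fintype ι] {w : ι → ι → ℝ} {x u : ι → ℝ} {ε X : ℝ}
    (hε : ε ≠ 0) (hw : ∀ i j, 0 ≤ w i j) (hs : ∀ i, 0 < ∑ j, w i j) (hu : ∀ i, 0 < u i)
    (hX0 : 0 < X) (hmean : ∀ i, ∑ j, w i j * x j = u i * x i * ∑ j, w i j)
    (h : ∀ i j, w i j ≠ 0 → 0 ≤ ε * (u i * u j - 1)) (hX : ∀ j, ε * x j ≤ ε * X)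
    {p q : ι} (hp : x p = X) (hq : w p q ≠ 0) :
    x q = u p * X ∧ u p * u q = 1 ∧ ∀ j, w q j ≠ 0 → x j = X := by
  have hA : ∀ q, w p q ≠ 0 → x q = u p * X := by
    refine eq_of_extremal_weighted_sum hε (hw p) (fun q hq => ?_) (by rw [hmean, hp])
    have h1 : ε * (u q * x q) ≤ ε * X := by
      have := weighted_sum_le (hw q) hX
      rw [hmean] at this
      exact le_of_mul_le_mul_right (by linarith) (hs q)
    have h2 := mul_nonneg (h p q hq) hX0.le
    refine le_of_mul_le_mul_left ?_ (hu q)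
    nlinarith
  have hxq := hA q hq
  have hB : ∀ j, w q j ≠ 0 → x j = X := by
    refine eq_of_extremal_weighted_sum hε (hw q) (fun j _ => hX j) ?_
    rw [hmean, hxq]
    have h2 := mul_nonneg (mul_nonneg (h p q hq) hX0.le) (hs q).le
    nlinarith
  refine ⟨hxq, ?_, hB⟩
  have h3 : ∑ j, w q j * x j = X * ∑ j, w q j := by
    rw [mul_sum]
    refine sum_congr rfl fun j _ => ?_
    by_cases h0 : w q j = 0
    · simp [h0]
    · rw [hB j h0, mul_comm]
  rw [hmean, hxq] at h3
  have h4 := mul_right_cancel₀ (hs q).ne' h3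
  exact mul_right_cancel₀ hX0.ne' (by linarith)

open Finset in
theorem Matrix.IsIrreducible.mul_eq_one_of_edge {ι : Type*} [Fintype ι] [DecidableEq ι]
    [Nonempty ι] {w : Matrix ι ι ℝ} (hirr : w.IsIrreducible) {x u : ι → ℝ} {ε : ℝ}
    (hε : ε ≠ 0) (hs : ∀ i, 0 < ∑ j, w i j) (hu : ∀ i, 0 < u i) (hx : ∀ i, 0 < x i)
    (hmean : ∀ i, ∑ j, w i j * x j = u i * x i * ∑ j, w i j)
    (h : ∀ i j, w i j ≠ 0 → 0 ≤ ε * (u i * u j - 1)) {i j : ι} (hij : w i j ≠ 0) :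
    u i * u j = 1 := by
  obtain ⟨i₀, -, hi₀⟩ := exists_max_image univ (fun i => ε * x i) univ_nonempty
  have hX : ∀ j, ε * x j ≤ ε * x i₀ := fun j => hi₀ j (mem_univ j)
  -- A second extremal choice, of `u` among the extremal points of `x`, keeps `u` constant along
  -- two-step walks from `p`.
  obtain ⟨p, hpmem, hpmax⟩ := exists_max_image (univ.filter fun i => x i = x i₀)
    (fun i => ε * u i) ⟨i₀, by simp⟩
  have hp : x p = x i₀ := by simpa using hpmem
  have step := fun {p q : ι} (hp : x p = x i₀) (hq : w p q ≠ 0) =>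
    neighbors_of_extremal hε hirr.nonneg hs hu (hx i₀) hmean h hX hp hq
  -- Edges lead from each of the two alternatives into the other, so their union is closed.
  have hall := hirr.forall_of_closed (i₀ := p)
    (p := fun i => (x i = x i₀ ∧ u i = u p) ∨ (u p * u i = 1 ∧ ∀ j, w i j ≠ 0 →
      x j = x i₀ ∧ u j = u p)) (Or.inl ⟨hp, rfl⟩) (by
    rintro i j (⟨hi, hui⟩ | ⟨-, hi⟩) hij
    · obtain ⟨-, h1, h2⟩ := step hi hij
      refine Or.inr ⟨hui ▸ h1, fun k hk => ⟨h2 k hk, ?_⟩⟩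
      have h3 := hpmax k (by simpa using h2 k hk)
      have h4 := h j k hk
      have h5 : ε * u i ≤ ε * u k := by
        refine le_of_mul_le_mul_right ?_ (hu j)
        linear_combination h4 + ε * h1
      exact mul_left_cancel₀ hε (le_antisymm h3 (hui ▸ h5))
    · exact Or.inl (hi j hij))
  rcases hall i with ⟨hi, hui⟩ | ⟨hi, hi'⟩
  · exact (step hi hij).2.1
  · rw [(hi' j hij).2, mul_comm, hi]

/-! ### Pair bounds in terms of `u i * u j`. -/

/-- `pairBound A t i j` is the larger root of `(z - t i) * (z - t j) = s i * s j / (r i * r j)`;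
hence its position relative to `c` is that of `1` relative to the normalized product at `c`. -/
theorem pairBound_le_iff {n : ℕ} {A : Matrix (Fin n) (Fin n) ℝ} {t : Fin n → ℝ} {c : ℝ}
    {i j : Fin n} (hr : ∀ i, 0 < rowSum A i) (hs : ∀ i, 0 < rowSum₂ A i) (hc : ∀ i, t i < c) :
    pairBound A t i j ≤ c ↔
      1 ≤ ((c - t i) * rowSum A i / rowSum₂ A i) * ((c - t j) * rowSum A j / rowSum₂ A j) := by
  have hi := hc i
  have hj := hc j
  -- Squaring is reversible because `2c - t i - t j > 0`, and `(2c - t i - t j)² - (t i - t j)² =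
  -- 4(c - t i)(c - t j)`.
  rw [pairBound, div_mul_div_comm, le_div_iff₀ (mul_pos (hs i) (hs j)), one_mul,
    div_le_iff₀ two_pos, ← le_sub_iff_add_le', Real.sqrt_le_left (by linarith),
    ← le_sub_iff_add_le', div_le_iff₀ (mul_pos (hr i) (hr j))]
  constructor <;> intro h <;> nlinarith

theorem le_pairBound_iff {n : ℕ} {A : Matrix (Fin n) (Fin n) ℝ} {t : Fin n → ℝ} {c : ℝ}
    {i j : Fin n} (hr : ∀ i, 0 < rowSum A i) (hs : ∀ i, 0 < rowSum₂ A i) (hc : ∀ i, t i < c) :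
    c ≤ pairBound A t i j ↔
      ((c - t i) * rowSum A i / rowSum₂ A i) * ((c - t j) * rowSum A j / rowSum₂ A j) ≤ 1 := by
  have hi := hc i
  have hj := hc j
  rw [pairBound, div_mul_div_comm, div_le_iff₀ (mul_pos (hs i) (hs j)), one_mul,
    le_div_iff₀ two_pos, ← sub_le_iff_le_add', Real.le_sqrt' (by linarith),
    ← sub_le_iff_le_add', le_div_iff₀ (mul_pos (hr i) (hr j))]
  constructor <;> intro h <;> nlinarith

theorem pairBound_eq_iff {n : ℕ} {A : Matrix (Fin n) (Fin n) ℝ} {t : Fin n → ℝ} {c : ℝ}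
    {i j : Fin n} (hr : ∀ i, 0 < rowSum A i) (hs : ∀ i, 0 < rowSum₂ A i) (hc : ∀ i, t i < c) :
    pairBound A t i j = c ↔
      ((c - t i) * rowSum A i / rowSum₂ A i) * ((c - t j) * rowSum A j / rowSum₂ A j) = 1 := by
  rw [le_antisymm_iff, le_antisymm_iff, pairBound_le_iff hr hs hc, le_pairBound_iff hr hs hc,
    and_comm]

/-! ### From equality on all edges to (i) or (ii). -/

/-- Any nonempty proper set of indices is moved to an initial segment by a permutation. -/
theorem Fin.exists_perm_lt_iff {n : ℕ} (p : Fin n → Prop) (h1 : ∃ i, p i) (h2 : ∃ i, ¬ p i) :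
    ∃ (σ : Equiv.Perm (Fin n)) (k : ℕ), 1 ≤ k ∧ k < n ∧ ∀ i, p (σ i) ↔ (i : ℕ) < k := by
  classical
  have hlt : Fintype.card {i // p i} < n := by
    obtain ⟨i, hi⟩ := h2
    simpa using Fintype.card_subtype_lt hi
  have hpos : 0 < Fintype.card {i // p i} := by
    obtain ⟨i, hi⟩ := h1
    exact Fintype.card_pos_iff.2 ⟨⟨i, hi⟩⟩
  set k := Fintype.card {i // p i} with hk
  have hcard : Fintype.card {i : Fin n // (i : ℕ) < k} = Fintype.card {i // p i} := by
    rw [← hk, Fintype.card_subtype, Fin.card_filter_val_lt, min_eq_right hlt.le]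
  let e := Fintype.equivOfCardEq hcard
  exact ⟨e.extendSubtype, k, hpos, hlt, fun i =>
    ⟨fun h => by_contra fun hi => e.extendSubtype_not_mem i hi h, e.extendSubtype_mem i⟩⟩

/-- The first block is the level set `u = l`. As `l ≠ 1`, neither `l²` nor `l⁻²` is `1`, so no edge
stays inside a level set. -/
theorem blockCond_of_mul_eq_one {n : ℕ} {A : Matrix (Fin n) (Fin n) ℝ} {t : Fin n → ℝ} {c l : ℝ}
    (hr : ∀ i, 0 < rowSum A i) (hs : ∀ i, 0 < rowSum₂ A i) {u : Fin n → ℝ}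
    (hu : ∀ i, u i = (c - t i) * rowSum A i / rowSum₂ A i) (hl : 0 < l) (hl1 : l ≠ 1)
    (h1 : ∃ i, u i = l) (h2 : ∃ i, u i = l⁻¹) (hall : ∀ i, u i = l ∨ u i = l⁻¹)
    (hedge : ∀ i j, A i j ≠ 0 → u i * u j = 1) : BlockCond A t l := by
  have hne : l⁻¹ ≠ l := fun h => hl1 (by
    have h3 : l * l = 1 := by rw [← mul_inv_cancel₀ hl.ne', h]
    nlinarith)
  have hsq : l * l ≠ 1 := fun h => hl1 (by nlinarith)
  have hsq' : l⁻¹ * l⁻¹ ≠ 1 := fun h => hsq (by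
    rw [← mul_inv] at h
    exact inv_eq_one.1 h)
  obtain ⟨σ, k, hk1, hkn, hσ⟩ := Fin.exists_perm_lt_iff (fun i => u i = l) h1
    (h2.imp fun i hi => by rwa [hi])
  refine ⟨σ, k, hk1, hkn, fun i j hij hk => ?_, c, fun i hi => ?_, fun j hj => ?_⟩
  · have hd : σ i ≠ σ j := σ.injective.ne hij
    simp only [Matrix.submatrix_apply, Matrix.add_apply, Matrix.diagonal_apply_ne _ hd, add_zero]
    by_contra hA
    have h3 := hedge _ _ hA
    have hiff : u (σ i) = l ↔ u (σ j) = l := by rw [hσ, hσ, hk]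
    by_cases h4 : u (σ i) = l
    · exact hsq (by rwa [h4, hiff.1 h4] at h3)
    · rw [(hall _).resolve_left h4, (hall _).resolve_left (hiff.not.1 h4)] at h3
      exact hsq' h3
  · have h3 := (hσ i).2 hi
    have := (hr (σ i)).ne'
    have := (hs (σ i)).ne'
    rw [← h3, hu]
    field_simp
    ring
  · have h3 := (hall (σ j)).resolve_left ((hσ j).not.2 (not_lt.2 hj))
    have hr' := (hr (σ j)).ne'
    have hs' := (hs (σ j)).ne'
    rw [hu, div_eq_iff hs'] at h3
    have h4 : (c - t (σ j)) * rowSum A (σ j) * l = rowSum₂ A (σ j) := by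
      rw [h3]
      field_simp
    rw [← h4]
    field_simp
    ring

/-- Unless `u` is identically `1`, it alternates along edges between two reciprocal values. Either
level set may serve as first block, so `l` can be taken on either side of `1`. -/
theorem constCond_or_blockCond {n : ℕ} {A : Matrix (Fin n) (Fin n) ℝ} {t : Fin n → ℝ} {c : ℝ}
    (hA : A.IsIrreducible) (hout : ∀ i, ∃ j, A i j ≠ 0)
    (hr : ∀ i, 0 < rowSum A i) (hs : ∀ i, 0 < rowSum₂ A i) (hc : ∀ i, t i < c)
    (h : ∀ i j, A i j ≠ 0 → pairBound A t i j = c) :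
    ConstCond A t ∨ ((∃ l : ℝ, 1 < l ∧ BlockCond A t l) ∧
      ∃ l : ℝ, 0 < l ∧ l < 1 ∧ BlockCond A t l) := by
  obtain ⟨u, hu⟩ : ∃ u : Fin n → ℝ, ∀ i, u i = (c - t i) * rowSum A i / rowSum₂ A i :=
    ⟨_, fun _ => rfl⟩
  have hu0 : ∀ i, 0 < u i := fun i => by
    rw [hu]
    exact div_pos (mul_pos (sub_pos.2 (hc i)) (hr i)) (hs i)
  have hedge : ∀ i j, A i j ≠ 0 → u i * u j = 1 := fun i j hij => by
    rw [hu, hu]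
    exact (pairBound_eq_iff hr hs hc).1 (h i j hij)
  by_cases h1 : ∀ i, u i = 1
  · left
    have : ∀ i, t i + rowSum₂ A i / rowSum A i = c := fun i => by
      have h2 := hu i
      rw [h1, eq_comm, div_eq_one_iff_eq (hs i).ne'] at h2
      rw [← h2, mul_div_cancel_right₀ _ (hr i).ne']
      ring
    exact fun i j => (this i).trans (this j).symm
  · right
    push Not at h1
    obtain ⟨p, hp⟩ := h1
    obtain ⟨q, hq⟩ := hout p
    have key : ∀ p q, u p ≠ 1 → u p * u q = 1 → BlockCond A t (u p) := fun p q hp hpq => by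
      refine blockCond_of_mul_eq_one hr hs hu (hu0 p) hp ⟨p, rfl⟩
        ⟨q, eq_inv_of_mul_eq_one_right hpq⟩ ?_ hedge
      refine hA.forall_of_closed (i₀ := p) (Or.inl rfl) fun i j hi hij => ?_
      have h3 := eq_inv_of_mul_eq_one_right (hedge i j hij)
      rcases hi with hi | hi
      · exact Or.inr (by rw [h3, hi])
      · exact Or.inl (by rw [h3, hi, inv_inv])
    have hpq := hedge p q hq
    have hqp : u q * u p = 1 := by rw [mul_comm, hpq]
    have hq1 : u q ≠ 1 := fun h0 => hp (by simpa [h0] using hpq)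
    rcases lt_or_gt_of_ne hp with hlt | hgt
    · refine ⟨⟨u q, ?_, key q p hq1 hqp⟩, u p, hu0 p, hlt, key p q hp hpq⟩
      nlinarith [hu0 q]
    · refine ⟨⟨u p, hgt, key p q hp hpq⟩, u q, hu0 q, ?_, key q p hq1 hqp⟩
      nlinarith [hu0 q]

/-! ### Explicit Perron vectors under (i) and (ii). -/

theorem mulVec_add_diagonal_apply {n : ℕ} (A : Matrix (Fin n) (Fin n) ℝ) (t v : Fin n → ℝ)
    (i : Fin n) : ((A + Matrix.diagonal t).mulVec v) i = ∑ j, A i j * v j + t i * v i := by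
  rw [Matrix.add_mulVec, Pi.add_apply, Matrix.mulVec_diagonal]
  rfl

/-- Under the constancy condition the row sums form a Perron vector. -/
theorem ConstCond.pairBound_eq_specRad {n : ℕ} [NeZero n] {A : Matrix (Fin n) (Fin n) ℝ}
    {t : Fin n → ℝ} (h : ConstCond A t) (hB : ∀ i j, 0 ≤ (A + Matrix.diagonal t) i j)
    (hr : ∀ i, 0 < rowSum A i) (hs : ∀ i, 0 < rowSum₂ A i)
    (hc : ∀ i, t i < specRad (A + Matrix.diagonal t)) (i j : Fin n) :
    pairBound A t i j = specRad (A + Matrix.diagonal t) := by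
  have hrad : ∀ i, t i + rowSum₂ A i / rowSum A i = specRad (A + Matrix.diagonal t) := fun k => by
    rw [h k 0]
    refine (specRad_eq_of_pos_eigenvector hB hr (funext fun i => ?_)).symm
    rw [mulVec_add_diagonal_apply, Pi.smul_apply, smul_eq_mul, h 0 i, add_mul,
      div_mul_cancel₀ _ (hr i).ne', add_comm]
    rfl
  have hu : ∀ i, (specRad (A + Matrix.diagonal t) - t i) * rowSum A i / rowSum₂ A i = 1 :=
    fun i => by
      rw [← hrad i, add_sub_cancel_left, div_mul_cancel₀ _ (hr i).ne', div_self (hs i).ne']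
  rw [pairBound_eq_iff hr hs hc, hu, hu, one_mul]

/-- Under the block condition, scaling the row sums of the second block by `l` gives a Perron
vector. -/
theorem BlockCond.pairBound_eq_specRad {n : ℕ} [NeZero n] {A : Matrix (Fin n) (Fin n) ℝ}
    {t : Fin n → ℝ} {l : ℝ} (h : BlockCond A t l) (hl : 0 < l) (hdiag : ∀ i, A i i = 0)
    (hB : ∀ i j, 0 ≤ (A + Matrix.diagonal t) i j)
    (hr : ∀ i, 0 < rowSum A i) (hs : ∀ i, 0 < rowSum₂ A i)
    (hc : ∀ i, t i < specRad (A + Matrix.diagonal t)) {i j : Fin n} (hij : A i j ≠ 0) :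
    pairBound A t i j = specRad (A + Matrix.diagonal t) := by
  classical
  obtain ⟨σ, k, -, -, hblock, c, h1, h2⟩ := h
  set U : Fin n → Prop := fun i => ((σ.symm i : Fin n) : ℕ) < k with hU
  have hcross : ∀ i j, A i j ≠ 0 → (U j ↔ ¬ U i) := fun i j hij => by
    have hne : i ≠ j := fun h0 => hij (h0 ▸ hdiag i)
    have h3 := hblock (σ.symm i) (σ.symm j) (σ.symm.injective.ne hne)
    simp only [Matrix.submatrix_apply, Equiv.apply_symm_apply, Matrix.add_apply,
      Matrix.diagonal_apply_ne _ hne, add_zero] at h3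
    have h4 : ¬ (U i ↔ U j) := fun h0 => hij (h3 h0)
    tauto
  have h1' : ∀ i, U i → (c - t i) * rowSum A i = l * rowSum₂ A i := fun i hi => by
    have h3 := h1 (σ.symm i) hi
    rw [Equiv.apply_symm_apply] at h3
    rw [← h3, add_sub_cancel_left, div_mul_cancel₀ _ (hr i).ne']
  have h2' : ∀ i, ¬ U i → (c - t i) * (l * rowSum A i) = rowSum₂ A i := fun i hi => by
    have h3 := h2 (σ.symm i) (not_lt.1 hi)
    rw [Equiv.apply_symm_apply] at h3
    rw [← h3, add_sub_cancel_left, div_mul_cancel₀ _ (mul_pos hl (hr i)).ne']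
  set v : Fin n → ℝ := fun i => if U i then rowSum A i else l * rowSum A i with hv
  have hvU : ∀ i, U i → v i = rowSum A i := fun i hi => if_pos hi
  have hvU' : ∀ i, ¬ U i → v i = l * rowSum A i := fun i hi => if_neg hi
  have hvpos : ∀ i, 0 < v i := fun i => by
    by_cases hi : U i
    · rw [hvU i hi]
      exact hr i
    · rw [hvU' i hi]
      exact mul_pos hl (hr i)
  have hrad : specRad (A + Matrix.diagonal t) = c := by
    refine specRad_eq_of_pos_eigenvector hB hvpos (funext fun i => ?_)
    rw [mulVec_add_diagonal_apply, Pi.smul_apply, smul_eq_mul]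
    by_cases hi : U i
    · have hsum : ∑ j, A i j * v j = l * rowSum₂ A i := by
        rw [rowSum₂, Finset.mul_sum]
        refine Finset.sum_congr rfl fun j _ => ?_
        by_cases h0 : A i j = 0
        · simp [h0]
        · rw [hvU' j fun hj => (hcross i j h0).1 hj hi]
          ring
      rw [hsum, hvU i hi, ← h1' i hi]
      ring
    · have hsum : ∑ j, A i j * v j = rowSum₂ A i := by
        refine Finset.sum_congr rfl fun j _ => ?_
        by_cases h0 : A i j = 0
        · simp [h0]
        · rw [hvU j ((hcross i j h0).2 hi)]
      rw [hsum, hvU' i hi, ← h2' i hi]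
      ring
  rw [pairBound_eq_iff hr hs hc, hrad]
  have hu1 : ∀ i, U i → (c - t i) * rowSum A i / rowSum₂ A i = l := fun i hi => by
    rw [h1' i hi, mul_div_cancel_right₀ _ (hs i).ne']
  have hu2 : ∀ i, ¬ U i → (c - t i) * rowSum A i / rowSum₂ A i = l⁻¹ := fun i hi => by
    rw [div_eq_iff (hs i).ne', ← h2' i hi]
    field_simp
  by_cases hi : U i
  · rw [hu1 i hi, hu2 j fun hj => (hcross i j hij).1 hj hi, mul_inv_cancel₀ hl.ne']
  · rw [hu2 i hi, hu1 j ((hcross i j hij).2 hi), inv_mul_cancel₀ hl.ne']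

/-! ### One-sided bounds and the main theorem. -/

/-- If all pair bounds lie on one side of the spectral radius, they all equal it.
The sign of `ε` selects the side. -/
theorem pairBound_eq_specRad_of_one_sided {n : ℕ} [NeZero n] {A : Matrix (Fin n) (Fin n) ℝ}
    {t : Fin n → ℝ} (hA : A.IsIrreducible) (hB : (A + Matrix.diagonal t).IsIrreducible)
    (hr : ∀ i, 0 < rowSum A i) (hs : ∀ i, 0 < rowSum₂ A i)
    (hc : ∀ i, t i < specRad (A + Matrix.diagonal t))
    (h : (∀ i j, A i j ≠ 0 → pairBound A t i j ≤ specRad (A + Matrix.diagonal t)) ∨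
      ∀ i j, A i j ≠ 0 → specRad (A + Matrix.diagonal t) ≤ pairBound A t i j)
    {i j : Fin n} (hij : A i j ≠ 0) :
    pairBound A t i j = specRad (A + Matrix.diagonal t) := by
  obtain ⟨c, y, hy, hcy⟩ := hB.exists_pos_eigenvector
  rw [specRad_eq_of_pos_eigenvector hB.nonneg hy hcy] at h hc ⊢
  have hw0 : ∀ i j, A i j * rowSum A j ≠ 0 → A i j ≠ 0 := fun i j => left_ne_zero_of_mul
  have hrow : ∀ i, ∑ j, A i j * y j = (c - t i) * y i := fun i => by
    have h1 := congrFun hcy i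
    rw [mulVec_add_diagonal_apply, Pi.smul_apply, smul_eq_mul] at h1
    linarith
  obtain ⟨u, hu⟩ : ∃ u : Fin n → ℝ, ∀ i, u i = (c - t i) * rowSum A i / rowSum₂ A i :=
    ⟨_, fun _ => rfl⟩
  have hu0 : ∀ i, 0 < u i := fun i => by
    rw [hu]
    exact div_pos (mul_pos (sub_pos.2 (hc i)) (hr i)) (hs i)
  obtain ⟨ε, hε, hεu⟩ : ∃ ε : ℝ, ε ≠ 0 ∧ ∀ i j, A i j ≠ 0 → 0 ≤ ε * (u i * u j - 1) := by
    rcases h with h | h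
    · refine ⟨1, one_ne_zero, fun i j hij => ?_⟩
      have := (pairBound_le_iff hr hs hc).1 (h i j hij)
      rw [← hu, ← hu] at this
      linarith
    · refine ⟨-1, by norm_num, fun i j hij => ?_⟩
      have := (le_pairBound_iff hr hs hc).1 (h i j hij)
      rw [← hu, ← hu] at this
      linarith
  have hwirr : (Matrix.of fun i j => A i j * rowSum A j).IsIrreducible := by
    refine ⟨fun i j => mul_nonneg (hA.nonneg i j) (hr j).le, ?_⟩
    -- Scaling columns by positive numbers does not change the support.
    have hq : (Matrix.of fun i j => A i j * rowSum A j).toQuiver = A.toQuiver := by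
      simp only [Matrix.toQuiver, Matrix.of_apply, mul_pos_iff_of_pos_right (hr _)]
    rw [hq]
    exact hA.connected
  rw [pairBound_eq_iff hr hs hc, ← hu, ← hu]
  refine hwirr.mul_eq_one_of_edge (x := fun i => y i / rowSum A i) hε hs hu0
    (fun i => div_pos (hy i) (hr i)) (fun i => ?_) (fun i j hw => hεu i j (hw0 i j hw))
    (mul_ne_zero hij (hr j).ne')
  have h1 : ∑ j, A i j * rowSum A j * (y j / rowSum A j) = ∑ j, A i j * y j :=
    Finset.sum_congr rfl fun j _ => by
      have := (hr j).ne'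
      field_simp
  have h2 : ∑ j, A i j * rowSum A j = rowSum₂ A i := rfl
  have hr' := (hr i).ne'
  have hs' := (hs i).ne'
  simp only [Matrix.of_apply]
  rw [h1, h2, hrow, hu]
  field_simp

theorem theorem2p1 (n : ℕ) (hn : 2 ≤ n) (A : Matrix (Fin n) (Fin n) ℝ)
    (hA : A.IsIrreducible) (hdiag : ∀ i, A i i = 0)
    (t : Fin n → ℝ) (ht : ∀ i, 0 ≤ t i) :
    ∃ m M : ℝ, IsLeast (pairBounds A t) m ∧ IsGreatest (pairBounds A t) M ∧
      m ≤ specRad (A + Matrix.diagonal t) ∧ specRad (A + Matrix.diagonal t) ≤ M ∧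
      (m = specRad (A + Matrix.diagonal t) ↔
        ConstCond A t ∨ ∃ l : ℝ, 0 < l ∧ BlockCond A t l) ∧
      (specRad (A + Matrix.diagonal t) = M ↔
        ConstCond A t ∨ ∃ l : ℝ, 0 < l ∧ BlockCond A t l) ∧
      (m = specRad (A + Matrix.diagonal t) →
        ConstCond A t ∨ ∃ l : ℝ, 1 < l ∧ BlockCond A t l) ∧
      (specRad (A + Matrix.diagonal t) = M →
        ConstCond A t ∨ ∃ l : ℝ, 0 < l ∧ l < 1 ∧ BlockCond A t l) := by
  have : NeZero n := ⟨by omega⟩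
  have : Nontrivial (Fin n) := Fin.nontrivial_iff_two_le.2 hn
  have hout : ∀ i, ∃ j, 0 < A i j := hA.exists_pos
  have hsum : ∀ v : Fin n → ℝ, (∀ i, 0 < v i) → ∀ i, 0 < ∑ j, A i j * v j := fun v hv i => by
    obtain ⟨j, hj⟩ := hout i
    exact Finset.sum_pos' (fun k _ => mul_nonneg (hA.nonneg i k) (hv k).le)
      ⟨j, Finset.mem_univ j, mul_pos hj (hv j)⟩
  have hr : ∀ i, 0 < rowSum A i := fun i => by
    simpa [rowSum] using hsum (fun _ => 1) (fun _ => one_pos) i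
  have hs : ∀ i, 0 < rowSum₂ A i := hsum _ hr
  have hB : (A + Matrix.diagonal t).IsIrreducible := hA.mono fun i j => by
    rw [Matrix.add_apply, Matrix.diagonal_apply]
    split_ifs
    · linarith [ht i]
    · linarith
  have hc : ∀ i, t i < specRad (A + Matrix.diagonal t) := fun i => by
    obtain ⟨c, y, hy, hcy⟩ := hB.exists_pos_eigenvector
    rw [specRad_eq_of_pos_eigenvector hB.nonneg hy hcy]
    have h1 := congrFun hcy i
    rw [mulVec_add_diagonal_apply, Pi.smul_apply, smul_eq_mul] at h1
    exact lt_of_mul_lt_mul_right (by linarith [hsum y hy i]) (hy i).le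
  have hout' : ∀ i, ∃ j, A i j ≠ 0 := fun i => (hout i).imp fun j hj => hj.ne'
  have hfin : (pairBounds A t).Finite := by
    refine (Set.finite_range fun p : Fin n × Fin n => pairBound A t p.1 p.2).subset ?_
    rintro _ ⟨i, j, -, rfl⟩
    exact ⟨(i, j), rfl⟩
  have hne : (pairBounds A t).Nonempty := by
    obtain ⟨j, hj⟩ := hout' 0
    exact ⟨_, 0, j, hj, rfl⟩
  obtain ⟨m, hm⟩ := hfin.exists_minimal hne
  obtain ⟨M, hM⟩ := hfin.exists_maximal hne
  have hm : IsLeast (pairBounds A t) m :=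
    ⟨hm.1, fun x hx => (le_total m x).elim id fun h => hm.2 hx h⟩
  have hM : IsGreatest (pairBounds A t) M :=
    ⟨hM.1, fun x hx => (le_total x M).elim id fun h => hM.2 hx h⟩
  set ρ := specRad (A + Matrix.diagonal t) with hρ
  -- The hypothesis `ρ ≤ m` covers the equality case and also a failure of the lower bound, which
  -- collapses to `m = ρ`; `hle` does the same for `M`.
  have hge : ρ ≤ m → ∀ i j, A i j ≠ 0 → pairBound A t i j = ρ := fun h i j hij =>
    pairBound_eq_specRad_of_one_sided hA hB hr hs hc
      (Or.inr fun i j hij => h.trans (hm.2 ⟨i, j, hij, rfl⟩)) hij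
  have hle : M ≤ ρ → ∀ i j, A i j ≠ 0 → pairBound A t i j = ρ := fun h i j hij =>
    pairBound_eq_specRad_of_one_sided hA hB hr hs hc
      (Or.inl fun i j hij => (hM.2 ⟨i, j, hij, rfl⟩).trans h) hij
  have hval : (∀ i j, A i j ≠ 0 → pairBound A t i j = ρ) → ∀ x ∈ pairBounds A t, x = ρ := by
    rintro h _ ⟨i, j, hij, rfl⟩
    exact h i j hij
  have hstruct := constCond_or_blockCond hA hout' hr hs hc
  have hconv : (ConstCond A t ∨ ∃ l : ℝ, 0 < l ∧ BlockCond A t l) →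
      ∀ i j, A i j ≠ 0 → pairBound A t i j = ρ := by
    rintro (h | ⟨l, hl, h⟩) i j hij
    · exact h.pairBound_eq_specRad hB.nonneg hr hs hc i j
    · exact h.pairBound_eq_specRad hl hdiag hB.nonneg hr hs hc hij
  have hcond : (∀ i j, A i j ≠ 0 → pairBound A t i j = ρ) →
      ConstCond A t ∨ ∃ l : ℝ, 0 < l ∧ BlockCond A t l := fun h =>
    (hstruct h).imp_right fun ⟨⟨l, hl, hb⟩, _⟩ => ⟨l, one_pos.trans hl, hb⟩
  refine ⟨m, M, hm, hM, ?_, ?_, ⟨fun h => hcond (hge h.ge), fun h => hval (hconv h) m hm.1⟩,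
    ⟨fun h => hcond (hle h.ge), fun h => (hval (hconv h) M hM.1).symm⟩,
    fun h => (hstruct (hge h.ge)).imp_right And.left,
    fun h => (hstruct (hle h.ge)).imp_right And.right⟩
  · exact (le_total m ρ).elim id fun h => (hval (hge h) m hm.1).le
  · exact (le_total ρ M).elim id fun h => (hval (hle h) M hM.1).ge
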